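/- Let $\Sigma^n$ be a smooth $n$-manifold and $f:\Sigma\to\mathbb R^m$ a smooth immersion (of arbitrary codimension), with induced Riemannian metric $g=f^*\langle\cdot,\cdot\rangle$. Let $R$ be the Riemann curvature tensor of $g$, with the sign convention that $R_{ijij}$ is the sectional curvature for orthonormal $e_i,e_j$ ($i\neq j$), and let $A(X,Y)=-(\overline\nabla_XY)^\perp$ be the (normal-valued) second fundamental form, where $\overline\nabla$ is the flat connection of $\mathbb R^m$. Let $\epsilon^{j_1\cdots j_r}_{i_1\cdots i_r}$ be the sign of the permutation $(i_1,\dots,i_r)\mapsto(j_1,\dots,j_r)$ if $i_1,\dots,i_r$ are distinct and $\{i_1,\dots,i_r\}=\{j_1,\dots,j_r\}$ with $j_1,\dots,j_r$ distinct, and $0$ otherwise. For $k\ge 1$ define the generalized Einstein tensor $E^{(k)}$ of $(\Sigma,g)$ and the Newton transformation $T^{2k}$ of $A$ by their components in an orthonormal frame $e_1,\dots,e_n$, with $A_{ij}=A(e_i,e_j)$: $$(E^{(k)})_i^{\,j}=\frac1{2^{k+1}}\sum_{\substack{i_1,\dots,i_{2k}\\ j_1,\dots,j_{2k}}}\epsilon^{j\,j_1\cdots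 j_{2k}}_{i\,i_1\cdots i_{2k}}\,R_{j_1j_2}{}^{i_1i_2}\cdots R_{j_{2k-1}j_{2k}}{}^{i_{2k-1}i_{2k}},$$ $$(T^{2k})_i^{\,j}=\frac1{(2k)!}\sum_{\substack{i_1,\dots,i_{2k}\\ j_1,\dots,j_{2k}}}\epsilon^{j\,j_1\cdots j_{2k}}_{i\,i_1\cdots i_{2k}}\,\langle A_{i_1j_1},A_{i_2j_2}\rangle\cdots\langle A_{i_{2k-1}j_{2k-1}},A_{i_{2k}j_{2k}}\rangle .$$ Then for every $k=1,\dots,\lfloor n/2\rfloor$, $$E^{(k)}=\frac{(2k)!}{2}\,T^{2k}$$ on $\Sigma$; that is, at every point and in every orthonormal frame, $(E^{(k)})_i^{\,j}=\frac{(2k)!}2\,(T^{2k})_i^{\,j}$ for all $i,j$. -/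

import Mathlib

open scoped Manifold ContDiff

noncomputable section

namespace Submfd

/-- The generalized Kronecker symbol with index tuples `I`, `J`: it is the sign of the permutation
carrying `I` to `J` if the entries of `I` are pairwise distinct and `J` is a rearrangement of `I`,
and `0` otherwise. (For injective `I` at most one term of the sum is nonzero.) -/
def kronecker {n r : ℕ} (I J : Fin r → Fin n) : ℝ :=
  open Classical in
  if Function.Injective I then
    ∑ σ : Equiv.Perm (Fin r), if J = I ∘ σ then ((Equiv.Perm.sign σ : ℤ) : ℝ) else 0
  else 0

/-- The position `2 s` in a tuple of length `2 k`. -/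
def evenPos {k : ℕ} (s : Fin k) : Fin (2 * k) := ⟨2 * s.1, by have := s.2; omega⟩

/-- The position `2 s + 1` in a tuple of length `2 k`. -/
def oddPos {k : ℕ} (s : Fin k) : Fin (2 * k) := ⟨2 * s.1 + 1, by have := s.2; omega⟩

section Coordinates

variable {n : ℕ}

/-- The partial derivative of `h` in the `i`-th coordinate direction. -/
def partialDeriv (i : Fin n) (h : EuclideanSpace ℝ (Fin n) → ℝ)
    (x : EuclideanSpace ℝ (Fin n)) : ℝ :=
  fderiv ℝ h x (EuclideanSpace.single i 1)

/-- The Christoffel symbol `Γ^l_{ij}` at `x` of the metric with coordinate matrix `G`. -/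
def christoffel (G : EuclideanSpace ℝ (Fin n) → Matrix (Fin n) (Fin n) ℝ) (i j l : Fin n)
    (x : EuclideanSpace ℝ (Fin n)) : ℝ :=
  (1 / 2) * ∑ s, (G x)⁻¹ l s *
    (partialDeriv i (fun y => G y j s) x + partialDeriv j (fun y => G y i s) x
      - partialDeriv s (fun y => G y i j) x)

/-- The coefficient of `∂_l` in
`R(∂_a, ∂_b) ∂_d = ∇_{∂_a} ∇_{∂_b} ∂_d - ∇_{∂_b} ∇_{∂_a} ∂_d`,
where `∇` is the Levi-Civita connection of the metric with coordinate matrix `G`. -/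
def curvatureCoeff (G : EuclideanSpace ℝ (Fin n) → Matrix (Fin n) (Fin n) ℝ) (a b d l : Fin n)
    (x : EuclideanSpace ℝ (Fin n)) : ℝ :=
  partialDeriv a (christoffel G b d l) x - partialDeriv b (christoffel G a d l) x
    + ∑ s, (christoffel G b d s x * christoffel G a s l x
      - christoffel G a d s x * christoffel G b s l x)

/-- The components `R_{abcd} = g(R(∂_a, ∂_b) ∂_d, ∂_c)` of the Riemann curvature tensor, with the
sign for which `R_{abab}` is the sectional curvature of an orthonormal pair. -/
def curvatureLower (G : EuclideanSpace ℝ (Fin n) → Matrix (Fin n) (Fin n) ℝ) (a b c d : Fin n)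
    (x : EuclideanSpace ℝ (Fin n)) : ℝ :=
  ∑ l, G x l c * curvatureCoeff G a b d l x

end Coordinates

section Intrinsic

variable {n : ℕ} {M : Type*} [TopologicalSpace M] [ChartedSpace (EuclideanSpace ℝ (Fin n)) M]

/-- The matrix `g(∂_i, ∂_j)` of the metric `g` in the chart `φ`, as a function of the
coordinates. -/
def coordMetric (g : ∀ q : M, TangentSpace (𝓡 n) q → TangentSpace (𝓡 n) q → ℝ)
    (φ : OpenPartialHomeomorph M (EuclideanSpace ℝ (Fin n)))
    (x : EuclideanSpace ℝ (Fin n)) : Matrix (Fin n) (Fin n) ℝ :=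
  Matrix.of fun i j =>
    g (φ.symm x) (mfderiv (𝓡 n) (𝓡 n) φ.symm x (EuclideanSpace.single i (1 : ℝ)))
      (mfderiv (𝓡 n) (𝓡 n) φ.symm x (EuclideanSpace.single j (1 : ℝ)))

/-- The `i`-th component at `p` of the tangent vector `v` with respect to the coordinate fields of
the chart at `p`. -/
def coordComponent (p : M) (v : TangentSpace (𝓡 n) p) (i : Fin n) : ℝ :=
  mvfderiv (𝓡 n) (chartAt (EuclideanSpace ℝ (Fin n)) p) p v i

/-- The Riemann curvature `(0,4)`-tensor `R(v, w, y, z)` at `p` of the Riemannian metric `g`,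
computed in the chart at `p`; `R(v, w, v, w)` is the sectional curvature if `v`, `w` are
orthonormal. -/
def riemann (g : ∀ q : M, TangentSpace (𝓡 n) q → TangentSpace (𝓡 n) q → ℝ) (p : M)
    (v w y z : TangentSpace (𝓡 n) p) : ℝ :=
  ∑ a, ∑ b, ∑ c, ∑ d,
    coordComponent p v a * coordComponent p w b * coordComponent p y c * coordComponent p z d *
      curvatureLower (coordMetric g (chartAt (EuclideanSpace ℝ (Fin n)) p)) a b c d
        (chartAt (EuclideanSpace ℝ (Fin n)) p p)

variable [IsManifold (𝓡 n) ∞ M]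

/-- `e 0, …, e (n-1)` are vector fields which are smooth near `p` and orthonormal at `p` for the
metric `g`. In particular, every smooth local orthonormal frame has this property at each point of
its domain. -/
structure IsOrthonormalFrameAt (g : ∀ q : M, TangentSpace (𝓡 n) q → TangentSpace (𝓡 n) q → ℝ)
    (e : Fin n → ∀ q : M, TangentSpace (𝓡 n) q) (p : M) : Prop where
  smooth : ∀ i, ContMDiffAt (𝓡 n) (𝓡 n).tangent ∞
    (fun q => (⟨q, e i q⟩ : TangentBundle (𝓡 n) M)) p
  orthonormal : ∀ i j, g p (e i p) (e j p) = if i = j then 1 else 0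

/-- The component `(E^{(k)})_i^j` at `p` of the generalized Einstein tensor of the metric `g`, in
the frame `e`, orthonormal at `p`:
`2^{-(k+1)} ∑ ε_{i i₁ … i_{2k}}^{j j₁ … j_{2k}} R_{j₁ j₂}^{i₁ i₂} ⋯
  R_{j_{2k-1} j_{2k}}^{i_{2k-1} i_{2k}}`. -/
def einsteinTensor (g : ∀ q : M, TangentSpace (𝓡 n) q → TangentSpace (𝓡 n) q → ℝ) (k : ℕ)
    (e : Fin n → ∀ q : M, TangentSpace (𝓡 n) q) (p : M) (i j : Fin n) : ℝ :=
  (1 / 2 ^ (k + 1)) * ∑ I : Fin (2 * k) → Fin n, ∑ J : Fin (2 * k) → Fin n,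
    kronecker (Fin.cons i I : Fin (2 * k + 1) → Fin n) (Fin.cons j J) *
      ∏ s : Fin k, riemann g p (e (J (evenPos s)) p) (e (J (oddPos s)) p)
        (e (I (evenPos s)) p) (e (I (oddPos s)) p)

end Intrinsic

section Extrinsic

variable {n m : ℕ} {M : Type*} [TopologicalSpace M] [ChartedSpace (EuclideanSpace ℝ (Fin n)) M]

/-- A smooth immersion of `M` into Euclidean space. -/
def IsSmoothImmersion (f : M → EuclideanSpace ℝ (Fin m)) : Prop :=
  ContMDiff (𝓡 n) (𝓡 m) ∞ f ∧ ∀ p, Function.Injective (mvfderiv (𝓡 n) f p)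

/-- The Riemannian metric induced on `M` by `f`. -/
def inducedMetric (f : M → EuclideanSpace ℝ (Fin m)) (p : M) (v w : TangentSpace (𝓡 n) p) : ℝ :=
  inner ℝ (mvfderiv (𝓡 n) f p v) (mvfderiv (𝓡 n) f p w)

/-- The orthogonal projection of the ambient space onto the normal space of `f` at `p`. -/
def normalProj (f : M → EuclideanSpace ℝ (Fin m)) (p : M) (u : EuclideanSpace ℝ (Fin m)) :
    EuclideanSpace ℝ (Fin m) :=
  (mvfderiv (𝓡 n) f p).rangeᗮ.starProjection u

/-- The second fundamental form `A(X, Y) = -(∇̄_X Y)^⊥` at `p`, where `∇̄_X Y` is the directional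
derivative along `X` of the vector-valued function `df(Y)`. -/
def secondFundamentalForm (f : M → EuclideanSpace ℝ (Fin m))
    (X Y : ∀ q : M, TangentSpace (𝓡 n) q) (p : M) : EuclideanSpace ℝ (Fin m) :=
  -normalProj (n := n) f p (mvfderiv (𝓡 n) (fun q => mvfderiv (𝓡 n) f q (Y q)) p (X p))

/-- The component `(T^{2k})_i^j` at `p` of the Newton transformation of even order `2k` of the
second fundamental form of `f`, in the frame `e`, orthonormal at `p`:
`(1 / (2k)!) ∑ ε_{i i₁ … i_{2k}}^{j j₁ … j_{2k}} ⟨A_{i₁ j₁}, A_{i₂ j₂}⟩ ⋯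
  ⟨A_{i_{2k-1} j_{2k-1}}, A_{i_{2k} j_{2k}}⟩`. -/
def newtonTensorEven (f : M → EuclideanSpace ℝ (Fin m)) (k : ℕ)
    (e : Fin n → ∀ q : M, TangentSpace (𝓡 n) q) (p : M) (i j : Fin n) : ℝ :=
  (1 / ((2 * k).factorial : ℝ)) * ∑ I : Fin (2 * k) → Fin n, ∑ J : Fin (2 * k) → Fin n,
    kronecker (Fin.cons i I : Fin (2 * k + 1) → Fin n) (Fin.cons j J) *
      ∏ s : Fin k, inner ℝ
        (secondFundamentalForm f (e (I (evenPos s))) (e (J (evenPos s))) p)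
        (secondFundamentalForm f (e (I (oddPos s))) (e (J (oddPos s))) p)

end Extrinsic

end Submfd

end

/-!
The identity rests on the Gauss equation. For an immersion into flat space it reads
`R(v, w, y, z) = ⟨N(v, y), N(w, z)⟩ - ⟨N(v, z), N(w, y)⟩`, where `N = -A` is the normal part of the
Hessian of the immersion. Substituting it into the product of `k` curvature factors turns each
factor into a difference of two terms which are exchanged by transposing the upper indices of that
factor. The Kronecker symbol changes sign under this transposition, so each difference may be
replaced by twice its first term (`Submfd.sum_mul_prod_sub_swap`). This gives a factor `2 ^ k`, and
what remains is the sum defining the Newton transformation, because `N` is symmetric.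

The curvature is defined through the Christoffel symbols of the metric in the chart at the point, so
the Gauss equation is proved by a computation in that chart. Let `F` be the immersion written in the
chart, with metric matrix `G`. The relation `∑ l, G l c * Γ^l_{ij} = ⟨∂_i ∂_j F, ∂_c F⟩` holds near
the point (`Submfd.IsInducedNear.sum_christoffel_mul`), and differentiating it avoids computing the
derivative of the inverse matrix. The third derivatives of `F` cancel in the curvature by symmetry,
and the remaining terms are those of the Gauss equation (`Submfd.IsInducedNear.curvatureLower_eq`,
`Submfd.riemann_inducedMetric`). The second fundamental form of two vector fields is `-N` of their
values, because the derivative of the coefficients of the second field gives a tangential term only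
(`Submfd.secondFundamentalForm_eq`).
-/

open scoped Manifold ContDiff

noncomputable section

namespace Submfd

/-! ### Antisymmetrization -/

/-- The generalized Kronecker symbol is alternating in its first index tuple. -/
lemma kronecker_comp_perm {n r : ℕ} (I J : Fin r → Fin n) (τ : Equiv.Perm (Fin r)) :
    kronecker (I ∘ τ) J = ((Equiv.Perm.sign τ : ℤ) : ℝ) * kronecker I J := by
  unfold kronecker
  by_cases hI : Function.Injective I
  · rw [if_pos hI, if_pos (hI.comp τ.injective), Finset.mul_sum]
    refine Fintype.sum_equiv (Equiv.mulLeft τ) _ _ fun σ => ?_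
    have h : (I ∘ τ) ∘ σ = I ∘ (Equiv.mulLeft τ σ) := rfl
    have hs : ((Equiv.Perm.sign τ : ℤ) : ℝ) * ((Equiv.Perm.sign τ : ℤ) : ℝ) = 1 := by
      rcases Int.units_eq_one_or (Equiv.Perm.sign τ) with h | h <;> simp [h]
    rw [h]
    split_ifs
    · simp only [Equiv.coe_mulLeft, Equiv.Perm.sign_mul, Units.val_mul, Int.cast_mul,
        ← mul_assoc, hs, one_mul]
    · simp
  · rw [if_neg hI, if_neg, mul_zero]
    intro h
    exact hI (by simpa [Function.comp_assoc] using h.comp τ.symm.injective)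

lemma kronecker_cons_comp_swap {n r : ℕ} (i j : Fin n) (I J : Fin r → Fin n) {a b : Fin r}
    (hab : a ≠ b) :
    kronecker (Fin.cons i (I ∘ Equiv.swap a b) : Fin (r + 1) → Fin n) (Fin.cons j J) =
      -kronecker (Fin.cons i I : Fin (r + 1) → Fin n) (Fin.cons j J) := by
  have h : (Fin.cons i (I ∘ Equiv.swap a b) : Fin (r + 1) → Fin n) =
      (Fin.cons i I : Fin (r + 1) → Fin n) ∘ Equiv.swap a.succ b.succ := by
    funext x
    refine Fin.cases ?_ (fun y => ?_) x
    · simp [Equiv.swap_apply_of_ne_of_ne (Fin.succ_ne_zero a).symm (Fin.succ_ne_zero b).symm]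
    · simp only [Fin.cons_succ, Function.comp_apply]
      rw [(Fin.succ_injective r).swap_apply, Fin.cons_succ]
  rw [h, kronecker_comp_perm, Equiv.Perm.sign_swap (by simpa using hab)]
  simp

lemma evenPos_ne_oddPos {k : ℕ} (s t : Fin k) : evenPos s ≠ oddPos t := by
  simp only [evenPos, oddPos, ne_eq, Fin.mk.injEq]; omega

lemma evenPos_injective {k : ℕ} : Function.Injective (evenPos (k := k)) := by
  intro s t h
  simp only [evenPos, Fin.mk.injEq] at h
  ext; omega

lemma oddPos_injective {k : ℕ} : Function.Injective (oddPos (k := k)) := by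
  intro s t h
  simp only [oddPos, Fin.mk.injEq] at h
  ext; omega

/-- Summed against a weight that changes sign under the transposition of the two entries of any
pair, each factor `c (x, y) - c (y, x)` of a product over pairs may be replaced by `2 c (x, y)`. -/
lemma sum_mul_prod_sub_swap {α : Type*} [Fintype α] {k : ℕ} (K : (Fin (2 * k) → α) → ℝ)
    (hK : ∀ I s, K (I ∘ Equiv.swap (evenPos s) (oddPos s)) = -K I)
    (c : Fin k → α → α → ℝ) :
    ∑ I, K I * ∏ s, (c s (I (evenPos s)) (I (oddPos s)) - c s (I (oddPos s)) (I (evenPos s))) =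
      2 ^ k * ∑ I, K I * ∏ s, c s (I (evenPos s)) (I (oddPos s)) := by
  classical
  -- The factors are treated one after the other: `S` holds the pairs still antisymmetrized.
  suffices h : ∀ S : Finset (Fin k),
      ∑ I, K I * ∏ s, (if s ∈ S then
          c s (I (evenPos s)) (I (oddPos s)) - c s (I (oddPos s)) (I (evenPos s))
        else c s (I (evenPos s)) (I (oddPos s))) =
      2 ^ S.card * ∑ I, K I * ∏ s, c s (I (evenPos s)) (I (oddPos s)) by
    simpa using h Finset.univ
  intro S
  induction S using Finset.induction_on with
  | empty => simp
  | insert t S ht ih =>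
    rw [Finset.card_insert_of_notMem ht, pow_succ', mul_assoc, ← ih]
    set d : Fin k → (Fin (2 * k) → α) → ℝ := fun s I => if s ∈ S then
          c s (I (evenPos s)) (I (oddPos s)) - c s (I (oddPos s)) (I (evenPos s))
        else c s (I (evenPos s)) (I (oddPos s)) with hd
    set τ := Equiv.swap (evenPos t) (oddPos t) with hτ
    have hsplit : ∀ I : Fin (2 * k) → α, ∏ s, (if s ∈ insert t S then
          c s (I (evenPos s)) (I (oddPos s)) - c s (I (oddPos s)) (I (evenPos s))
        else c s (I (evenPos s)) (I (oddPos s))) = ∏ s, d s I - ∏ s, d s (I ∘ τ) := by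
      intro I
      have hrest : ∀ s ∈ Finset.univ.erase t, d s (I ∘ τ) = d s I := by
        intro s hs
        have hst : s ≠ t := Finset.ne_of_mem_erase hs
        have h1 : τ (evenPos s) = evenPos s := Equiv.swap_apply_of_ne_of_ne
          (evenPos_injective.ne hst) (evenPos_ne_oddPos s t)
        have h2 : τ (oddPos s) = oddPos s := Equiv.swap_apply_of_ne_of_ne
          (evenPos_ne_oddPos t s).symm (oddPos_injective.ne hst)
        simp only [hd, Function.comp_apply, h1, h2]
      rw [← Finset.mul_prod_erase _ _ (Finset.mem_univ t),
        ← Finset.mul_prod_erase Finset.univ (fun s => d s I) (Finset.mem_univ t),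
        ← Finset.mul_prod_erase Finset.univ (fun s => d s (I ∘ τ)) (Finset.mem_univ t),
        Finset.prod_congr rfl hrest, ← sub_mul]
      congr 1
      · simp [hd, ht, hτ]
      · refine Finset.prod_congr rfl fun s hs => ?_
        simp [hd, Finset.mem_insert, Finset.ne_of_mem_erase hs]
    have hsum : ∑ I, K I * ∏ s, d s (I ∘ τ) = -∑ I, K I * ∏ s, d s I := by
      rw [← Finset.sum_neg_distrib]
      refine Fintype.sum_equiv (Equiv.arrowCongr τ (Equiv.refl α)) _ _ fun I => ?_
      have h : Equiv.arrowCongr τ (Equiv.refl α) I = I ∘ τ := by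
        funext x; simp [hτ]
      rw [h, hK]; ring
    simp only [hsplit, mul_sub, Finset.sum_sub_distrib]
    rw [hsum]; ring

/-! ### The Gauss equation in coordinates -/

section Coordinates

open Filter Topology

variable {n : ℕ} {V : Type*} [NormedAddCommGroup V] [InnerProductSpace ℝ V]

/-- The partial derivative of a vector-valued map in the `i`-th coordinate direction. -/
def vectorPartial (i : Fin n) (h : EuclideanSpace ℝ (Fin n) → V) (x : EuclideanSpace ℝ (Fin n)) : V :=
  fderiv ℝ h x (EuclideanSpace.single i 1)

lemma _root_.ContDiffAt.vectorPartial {h : EuclideanSpace ℝ (Fin n) → V}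
    {x : EuclideanSpace ℝ (Fin n)} (hh : ContDiffAt ℝ ∞ h x) (i : Fin n) :
    ContDiffAt ℝ ∞ (vectorPartial i h) x :=
  (hh.fderiv_right (m := ∞) le_rfl).clm_apply contDiffAt_const

lemma vectorPartial_comm {h : EuclideanSpace ℝ (Fin n) → V} {x : EuclideanSpace ℝ (Fin n)}
    (hh : ContDiffAt ℝ ∞ h x) (i j : Fin n) :
    vectorPartial i (vectorPartial j h) x = vectorPartial j (vectorPartial i h) x := by
  have hd : DifferentiableAt ℝ (fderiv ℝ h) x :=
    (hh.fderiv_right (m := ∞) le_rfl).differentiableAt (by simp)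
  have key : ∀ i j : Fin n, vectorPartial i (vectorPartial j h) x =
      fderiv ℝ (fderiv ℝ h) x (EuclideanSpace.single i 1) (EuclideanSpace.single j 1) := by
    intro i j
    unfold vectorPartial
    rw [fderiv_clm_apply hd (differentiableAt_const _)]
    simp
  rw [key, key]
  exact hh.isSymmSndFDerivAt
    (by simpa using WithTop.coe_le_coe.2 (OrderTop.le_top (2 : ℕ∞))) _ _

lemma partialDeriv_inner {u v : EuclideanSpace ℝ (Fin n) → V} {x : EuclideanSpace ℝ (Fin n)}
    (hu : DifferentiableAt ℝ u x)
    (hv : DifferentiableAt ℝ v x) (i : Fin n) :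
    partialDeriv i (fun y => inner ℝ (u y) (v y)) x =
      inner ℝ (u x) (vectorPartial i v x) + inner ℝ (vectorPartial i u x) (v x) :=
  fderiv_inner_apply ℝ hu hv _

lemma partialDeriv_congr {u v : EuclideanSpace ℝ (Fin n) → ℝ} {x : EuclideanSpace ℝ (Fin n)}
    (h : u =ᶠ[𝓝 x] v) (i : Fin n) :
    partialDeriv i u x = partialDeriv i v x := by
  unfold partialDeriv; rw [h.fderiv_eq]

lemma partialDeriv_sum_mul {ι : Type*} [Fintype ι]
    {u v : ι → EuclideanSpace ℝ (Fin n) → ℝ} {x : EuclideanSpace ℝ (Fin n)}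
    (hu : ∀ l, DifferentiableAt ℝ (u l) x) (hv : ∀ l, DifferentiableAt ℝ (v l) x) (i : Fin n) :
    partialDeriv i (fun y => ∑ l, u l y * v l y) x =
      ∑ l, (u l x * partialDeriv i (v l) x + partialDeriv i (u l) x * v l x) := by
  unfold partialDeriv
  rw [fderiv_fun_sum fun l _ => (hu l).fun_mul (hv l), sum_apply]
  refine Finset.sum_congr rfl fun l _ => ?_
  rw [fderiv_fun_mul (hu l) (hv l)]
  simp [mul_comm]

lemma differentiableAt_matrix_inv_apply {W : Type*} [NormedAddCommGroup W] [NormedSpace ℝ W]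
    {G : W → Matrix (Fin n) (Fin n) ℝ} {x : W}
    (hG : ∀ i j, DifferentiableAt ℝ (fun y => G y i j) x) (hdet : (G x).det ≠ 0) (i j : Fin n) :
    DifferentiableAt ℝ (fun y => (G y)⁻¹ i j) x := by
  have hd : ∀ H : W → Matrix (Fin n) (Fin n) ℝ, (∀ i j, DifferentiableAt ℝ (fun y => H y i j) x) →
      DifferentiableAt ℝ (fun y => (H y).det) x := by
    intro H hH
    simp only [Matrix.det_apply']
    exact DifferentiableAt.fun_sum fun σ _ => (differentiableAt_const _).mul
      (HasFDerivAt.finsetProd fun l _ => (hH (σ l) l).hasFDerivAt).differentiableAt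
  -- By Cramer's rule the entries of the inverse are quotients of determinants.
  simp only [Matrix.inv_def, Matrix.smul_apply, Ring.inverse_eq_inv', smul_eq_mul,
    Matrix.adjugate_apply]
  refine ((hd G hG).inv hdet).mul (hd _ fun a b => ?_)
  by_cases h : a = j
  · subst h; simp
  · simpa [Matrix.updateRow_ne h] using hG a b

/-- The Gram matrix of the images of the standard basis under an injective map is invertible. -/
lemma det_ne_zero_of_injective {L : EuclideanSpace ℝ (Fin n) →L[ℝ] V} (hL : Function.Injective L) :
    (Matrix.of fun i j : Fin n => inner ℝ (L (EuclideanSpace.single i 1))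
      (L (EuclideanSpace.single j 1)) : Matrix (Fin n) (Fin n) ℝ).det ≠ 0 := by
  have h : LinearIndependent ℝ fun i : Fin n => L (EuclideanSpace.single i 1) := by
    simpa [Function.comp_def] using
      (EuclideanSpace.basisFun (Fin n) ℝ).toBasis.linearIndependent.map' L.toLinearMap
        (LinearMap.ker_eq_bot.2 hL)
  exact (Matrix.posDef_gram_of_linearIndependent h).det_pos.ne'

/-- Near `x`, the map `F` is a smooth immersion and `G` is the coordinate matrix of the metric
induced by it. The three conditions are required on a neighbourhood, since the curvature at `x`
involves derivatives of the Christoffel symbols. -/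
structure IsInducedNear (F : EuclideanSpace ℝ (Fin n) → V)
    (G : EuclideanSpace ℝ (Fin n) → Matrix (Fin n) (Fin n) ℝ) (x : EuclideanSpace ℝ (Fin n)) : Prop where
  eventually_contDiffAt : ∀ᶠ y in 𝓝 x, ContDiffAt ℝ ∞ F y
  injective : ∀ᶠ y in 𝓝 x, Function.Injective (fderiv ℝ F y)
  metric_eq : ∀ᶠ y in 𝓝 x, G y =
    Matrix.of fun i j => inner ℝ (vectorPartial i F y) (vectorPartial j F y)

/-- The part of `∂_b ∂_d F` that remains after its tangential component, written with the
Christoffel symbols of `G`, is removed. -/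
def normalHessian (F : EuclideanSpace ℝ (Fin n) → V)
    (G : EuclideanSpace ℝ (Fin n) → Matrix (Fin n) (Fin n) ℝ) (x : EuclideanSpace ℝ (Fin n))
    (b d : Fin n) : V :=
  vectorPartial b (vectorPartial d F) x - ∑ l, christoffel G b d l x • vectorPartial l F x

namespace IsInducedNear

variable {F : EuclideanSpace ℝ (Fin n) → V}
  {G : EuclideanSpace ℝ (Fin n) → Matrix (Fin n) (Fin n) ℝ} {x : EuclideanSpace ℝ (Fin n)}

lemma eventually (h : IsInducedNear F G x) : ∀ᶠ y in 𝓝 x, IsInducedNear F G y := by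
  filter_upwards [h.eventually_contDiffAt.eventually_nhds, h.injective.eventually_nhds,
    h.metric_eq.eventually_nhds] with y h1 h2 h3 using ⟨h1, h2, h3⟩

lemma contDiffAt (h : IsInducedNear F G x) : ContDiffAt ℝ ∞ F x :=
  h.eventually_contDiffAt.self_of_nhds

lemma det_ne_zero (h : IsInducedNear F G x) : (G x).det ≠ 0 := by
  rw [h.metric_eq.self_of_nhds]
  exact det_ne_zero_of_injective h.injective.self_of_nhds

lemma apply_eventuallyEq (h : IsInducedNear F G x) (i j : Fin n) :
    (fun y => G y i j) =ᶠ[𝓝 x] fun y => inner ℝ (vectorPartial i F y) (vectorPartial j F y) := by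
  filter_upwards [h.metric_eq] with y hy
  rw [hy, Matrix.of_apply]

lemma differentiableAt_partial (h : IsInducedNear F G x) (i : Fin n) :
    DifferentiableAt ℝ (vectorPartial i F) x :=
  (h.contDiffAt.vectorPartial i).differentiableAt (by simp)

lemma differentiableAt_partial₂ (h : IsInducedNear F G x) (i j : Fin n) :
    DifferentiableAt ℝ (vectorPartial i (vectorPartial j F)) x :=
  ((h.contDiffAt.vectorPartial j).vectorPartial i).differentiableAt (by simp)

lemma differentiableAt_metric (h : IsInducedNear F G x) (i j : Fin n) :
    DifferentiableAt ℝ (fun y => G y i j) x :=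
  ((h.differentiableAt_partial i).inner ℝ (h.differentiableAt_partial j)).congr_of_eventuallyEq
    (h.apply_eventuallyEq i j)

lemma partialDeriv_metric (h : IsInducedNear F G x) (a i j : Fin n) :
    partialDeriv a (fun y => G y i j) x =
      inner ℝ (vectorPartial i F x) (vectorPartial a (vectorPartial j F) x) +
        inner ℝ (vectorPartial a (vectorPartial i F) x) (vectorPartial j F x) := by
  rw [partialDeriv_congr (h.apply_eventuallyEq i j),
    partialDeriv_inner (h.differentiableAt_partial i) (h.differentiableAt_partial j)]

/-- The Christoffel symbols of an induced metric are the tangential components of the second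
partial derivatives of the immersion. -/
lemma christoffel_eq (h : IsInducedNear F G x) (i j l : Fin n) :
    christoffel G i j l x = ∑ s, (G x)⁻¹ l s *
      inner ℝ (vectorPartial i (vectorPartial j F) x) (vectorPartial s F x) := by
  unfold christoffel
  rw [Finset.mul_sum]
  refine Finset.sum_congr rfl fun s _ => ?_
  rw [h.partialDeriv_metric, h.partialDeriv_metric, h.partialDeriv_metric,
    vectorPartial_comm h.contDiffAt j i, vectorPartial_comm h.contDiffAt s i,
    vectorPartial_comm h.contDiffAt s j, real_inner_comm _ (vectorPartial j F x),
    real_inner_comm _ (vectorPartial i F x)]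
  ring

/-- The tangential components of the second partial derivatives of the immersion, free of the
inverse of the metric. -/
lemma sum_christoffel_mul (h : IsInducedNear F G x) (i j c : Fin n) :
    ∑ l, G x l c * christoffel G i j l x =
      inner ℝ (vectorPartial i (vectorPartial j F) x) (vectorPartial c F x) := by
  have hsymm : ∀ l, G x l c = G x c l := by
    intro l
    rw [h.metric_eq.self_of_nhds, Matrix.of_apply, Matrix.of_apply, real_inner_comm]
  have hmul : G x * (G x)⁻¹ = 1 := Matrix.mul_nonsing_inv _ h.det_ne_zero.isUnit
  simp only [h.christoffel_eq, hsymm, Finset.mul_sum, ← mul_assoc]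
  rw [Finset.sum_comm]
  simp only [← Finset.sum_mul, ← Matrix.mul_apply, hmul, Matrix.one_apply, ite_mul, one_mul,
    zero_mul, Finset.sum_ite_eq, Finset.mem_univ, if_true]

lemma differentiableAt_christoffel (h : IsInducedNear F G x) (i j l : Fin n) :
    DifferentiableAt ℝ (christoffel G i j l) x := by
  have he : christoffel G i j l =ᶠ[𝓝 x] fun y => ∑ s, (G y)⁻¹ l s *
      inner ℝ (vectorPartial i (vectorPartial j F) y) (vectorPartial s F y) := by
    filter_upwards [h.eventually] with y hy using hy.christoffel_eq i j l
  refine DifferentiableAt.congr_of_eventuallyEq ?_ he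
  exact DifferentiableAt.fun_sum fun s _ =>
    (differentiableAt_matrix_inv_apply h.differentiableAt_metric h.det_ne_zero l s).mul
      ((h.differentiableAt_partial₂ i j).inner ℝ (h.differentiableAt_partial s))

lemma inner_normalHessian (h : IsInducedNear F G x) (b d c : Fin n) :
    inner ℝ (normalHessian F G x b d) (vectorPartial c F x) = 0 := by
  rw [normalHessian, inner_sub_left, ← h.sum_christoffel_mul, sum_inner, sub_eq_zero]
  refine Finset.sum_congr rfl fun l _ => ?_
  rw [h.metric_eq.self_of_nhds, Matrix.of_apply, real_inner_smul_left, mul_comm]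

/-- Lowering the index of `∂_a Γ_{bd}` and adding the quadratic term leaves the third derivative of
the immersion and a product of second derivatives. -/
lemma sum_mul_partialDeriv_christoffel (h : IsInducedNear F G x) (a b c d : Fin n) :
    ∑ l, G x l c * (partialDeriv a (christoffel G b d l) x +
        ∑ s, christoffel G b d s x * christoffel G a s l x) =
      inner ℝ (vectorPartial a (vectorPartial b (vectorPartial d F)) x) (vectorPartial c F x) +
        inner ℝ (normalHessian F G x b d) (vectorPartial a (vectorPartial c F) x) := by
  have h1 : partialDeriv a (fun y => ∑ l, G y l c * christoffel G b d l y) x =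
      partialDeriv a (fun y => inner ℝ (vectorPartial b (vectorPartial d F) y)
        (vectorPartial c F y)) x := by
    refine partialDeriv_congr ?_ a
    filter_upwards [h.eventually] with y hy using hy.sum_christoffel_mul b d c
  rw [partialDeriv_sum_mul (fun l => h.differentiableAt_metric l c)
      (fun l => h.differentiableAt_christoffel b d l),
    partialDeriv_inner (h.differentiableAt_partial₂ b d) (h.differentiableAt_partial c),
    Finset.sum_add_distrib] at h1
  -- The quadratic term equals the first of the two sums in `h3`, so that the two cancel.
  have h2 : ∑ l, G x l c * ∑ s, christoffel G b d s x * christoffel G a s l x =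
      ∑ s, christoffel G b d s x *
        inner ℝ (vectorPartial a (vectorPartial s F) x) (vectorPartial c F x) := by
    simp only [Finset.mul_sum, ← h.sum_christoffel_mul]
    rw [Finset.sum_comm]
    exact Finset.sum_congr rfl fun s _ => Finset.sum_congr rfl fun l _ => by ring
  have h3 : ∑ l, partialDeriv a (fun y => G y l c) x * christoffel G b d l x =
      ∑ s, christoffel G b d s x *
        inner ℝ (vectorPartial a (vectorPartial s F) x) (vectorPartial c F x) +
      ∑ l, christoffel G b d l x *
        inner ℝ (vectorPartial l F x) (vectorPartial a (vectorPartial c F) x) := by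
    rw [← Finset.sum_add_distrib]
    exact Finset.sum_congr rfl fun l _ => by rw [h.partialDeriv_metric]; ring
  simp only [mul_add, Finset.sum_add_distrib]
  rw [h2, normalHessian, inner_sub_left, sum_inner]
  simp only [real_inner_smul_left]
  linarith

/-- The Gauss equation in coordinates. The third derivatives of the immersion cancel because they
are symmetric. -/
lemma curvatureLower_eq (h : IsInducedNear F G x) (a b c d : Fin n) :
    curvatureLower G a b c d x =
      inner ℝ (normalHessian F G x b d) (vectorPartial a (vectorPartial c F) x) -
        inner ℝ (normalHessian F G x a d) (vectorPartial b (vectorPartial c F) x) := by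
  have h1 := h.sum_mul_partialDeriv_christoffel a b c d
  have h2 := h.sum_mul_partialDeriv_christoffel b a c d
  rw [vectorPartial_comm (h.contDiffAt.vectorPartial d) b a] at h2
  have h3 : curvatureLower G a b c d x =
      ∑ l, G x l c * (partialDeriv a (christoffel G b d l) x +
        ∑ s, christoffel G b d s x * christoffel G a s l x) -
      ∑ l, G x l c * (partialDeriv b (christoffel G a d l) x +
        ∑ s, christoffel G a d s x * christoffel G b s l x) := by
    rw [← Finset.sum_sub_distrib]
    refine Finset.sum_congr rfl fun l _ => ?_
    rw [curvatureCoeff, Finset.sum_sub_distrib]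
    ring
  rw [h3, h1, h2]
  ring

/-- The normal part of the Hessian of the immersion is its orthogonal projection onto the
normal space. -/
lemma normalHessian_eq_starProjection (h : IsInducedNear F G x) (b d : Fin n) :
    normalHessian F G x b d =
      ((fderiv ℝ F x).rangeᗮ).starProjection (vectorPartial b (vectorPartial d F) x) := by
  refine (Submodule.eq_starProjection_of_mem_orthogonal ?_ ?_).symm
  · rw [Submodule.mem_orthogonal']
    rintro _ ⟨v, rfl⟩
    have hv : v = ∑ i, v i • EuclideanSpace.single i (1 : ℝ) := by
      simpa using ((EuclideanSpace.basisFun (Fin n) ℝ).sum_repr v).symm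
    rw [hv, map_sum, inner_sum]
    refine Finset.sum_eq_zero fun i _ => ?_
    rw [map_smul, real_inner_smul_right]
    exact mul_eq_zero_of_right _ (h.inner_normalHessian b d i)
  · rw [normalHessian, sub_sub_cancel]
    refine Submodule.le_orthogonal_orthogonal _ (Submodule.sum_mem _ fun l _ => ?_)
    exact Submodule.smul_mem _ _ ⟨_, rfl⟩

end IsInducedNear

end Coordinates

/-! ### Immersions in the chart at a point -/

section Immersion

open Filter Topology

variable {n m : ℕ} {M : Type*} [TopologicalSpace M] [ChartedSpace (EuclideanSpace ℝ (Fin n)) M]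

/-- The expression of `f` in the chart at `p`. -/
def inChart (f : M → EuclideanSpace ℝ (Fin m)) (p : M) :
    EuclideanSpace ℝ (Fin n) → EuclideanSpace ℝ (Fin m) :=
  f ∘ (chartAt (EuclideanSpace ℝ (Fin n)) p).symm

/-- The tangent vector `v` at `q` in the coordinates of the chart at `p`. -/
def coordVector (p q : M) (v : TangentSpace (𝓡 n) q) : EuclideanSpace ℝ (Fin n) :=
  mvfderiv (𝓡 n) (chartAt (EuclideanSpace ℝ (Fin n)) p) q v

/-- The second fundamental form with the opposite sign, in the coordinates of the chart at `p`: the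
normal part of the Hessian of `f`. -/
def normalForm (f : M → EuclideanSpace ℝ (Fin m)) (p : M) (v w : EuclideanSpace ℝ (Fin n)) :
    EuclideanSpace ℝ (Fin m) :=
  (fderiv ℝ (inChart f p) (chartAt (EuclideanSpace ℝ (Fin n)) p p)).rangeᗮ.starProjection
    (fderiv ℝ (fderiv ℝ (inChart f p)) (chartAt (EuclideanSpace ℝ (Fin n)) p p) v w)

lemma sum_coord_mul_inner {V : Type*} [NormedAddCommGroup V] [InnerProductSpace ℝ V]
    (S : EuclideanSpace ℝ (Fin n) →ₗ[ℝ] EuclideanSpace ℝ (Fin n) →ₗ[ℝ] V)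
    (v w y z : EuclideanSpace ℝ (Fin n)) :
    ∑ a, ∑ b, ∑ c, ∑ d, v a * w b * y c * z d *
        inner ℝ (S (EuclideanSpace.single a 1) (EuclideanSpace.single c 1))
          (S (EuclideanSpace.single b 1) (EuclideanSpace.single d 1)) =
      inner ℝ (S v y) (S w z) := by
  have hexp : ∀ v y, S v y = ∑ a, ∑ c, (v a * y c) •
      S (EuclideanSpace.single a 1) (EuclideanSpace.single c 1) := by
    intro v y
    have hx : ∀ x : EuclideanSpace ℝ (Fin n),
        ∑ i, x i • EuclideanSpace.single i (1 : ℝ) = x := fun x => by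
      simpa using (EuclideanSpace.basisFun (Fin n) ℝ).sum_repr x
    conv_lhs => rw [← hx v, ← hx y]
    simp only [map_sum, map_smul, LinearMap.sum_apply, LinearMap.smul_apply, Finset.smul_sum,
      smul_smul]
    rw [Finset.sum_comm]
    simp only [mul_comm]
  rw [hexp v y, hexp w z]
  simp only [sum_inner]
  simp only [inner_sum, real_inner_smul_left, real_inner_smul_right]
  refine Finset.sum_congr rfl fun a _ => ?_
  rw [Finset.sum_comm]
  refine Finset.sum_congr rfl fun c _ => Finset.sum_congr rfl fun b _ =>
    Finset.sum_congr rfl fun d _ => by ring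

/-- The normal form as a bilinear map. -/
def normalFormₗ (f : M → EuclideanSpace ℝ (Fin m)) (p : M) :
    EuclideanSpace ℝ (Fin n) →ₗ[ℝ] EuclideanSpace ℝ (Fin n) →ₗ[ℝ] EuclideanSpace ℝ (Fin m) :=
  LinearMap.mk₂ ℝ (normalForm f p)
    (fun _ _ _ => by simp only [normalForm, map_add, add_apply])
    (fun _ _ _ => by simp only [normalForm, map_smul, smul_apply])
    (fun _ _ _ => by simp only [normalForm, map_add])
    (fun _ _ _ => by simp only [normalForm, map_smul])

lemma normalFormₗ_apply (f : M → EuclideanSpace ℝ (Fin m)) (p : M)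
    (v w : EuclideanSpace ℝ (Fin n)) : normalFormₗ f p v w = normalForm f p v w := rfl

variable [IsManifold (𝓡 n) ∞ M] {f : M → EuclideanSpace ℝ (Fin m)}

lemma contDiffAt_inChart (hf : IsSmoothImmersion (n := n) f) (p : M)
    {y : EuclideanSpace ℝ (Fin n)}
    (hy : y ∈ (chartAt (EuclideanSpace ℝ (Fin n)) p).target) :
    ContDiffAt ℝ ∞ (inChart f p) y := by
  rw [← contMDiffAt_iff_contDiffAt]
  exact hf.1.contMDiffAt.comp y (contMDiffOn_chart_symm.contMDiffAt
    ((chartAt (EuclideanSpace ℝ (Fin n)) p).open_target.mem_nhds hy))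

/-- The chain rule for `f` and the inverse chart. The tangent spaces of the two vector spaces are
identified definitionally with these spaces. -/
lemma fderiv_inChart (hf : IsSmoothImmersion (n := n) f) (p : M) {y : EuclideanSpace ℝ (Fin n)}
    (hy : y ∈ (chartAt (EuclideanSpace ℝ (Fin n)) p).target) (w : EuclideanSpace ℝ (Fin n)) :
    fderiv ℝ (inChart f p) y w =
      mvfderiv (𝓡 n) f ((chartAt (EuclideanSpace ℝ (Fin n)) p).symm y)
        (mfderiv (𝓡 n) (𝓡 n) (chartAt (EuclideanSpace ℝ (Fin n)) p).symm y w) := by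
  have : IsManifold (𝓡 n) 1 M := IsManifold.of_le (n := ∞) (by simp)
  rw [← mfderiv_eq_fderiv]
  exact mfderiv_comp_apply y (hf.1.mdifferentiableAt (by simp))
    ((mdifferentiable_chart p).mdifferentiableAt_symm hy) w

lemma mvfderiv_comp_chart {V : Type*} [NormedAddCommGroup V] [NormedSpace ℝ V]
    {h : EuclideanSpace ℝ (Fin n) → V} {p q : M}
    (hq : q ∈ (chartAt (EuclideanSpace ℝ (Fin n)) p).source)
    (hh : DifferentiableAt ℝ h (chartAt (EuclideanSpace ℝ (Fin n)) p q))
    (v : TangentSpace (𝓡 n) q) :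
    mvfderiv (𝓡 n) (h ∘ chartAt (EuclideanSpace ℝ (Fin n)) p) q v =
      fderiv ℝ h (chartAt (EuclideanSpace ℝ (Fin n)) p q) (coordVector p q v) := by
  have : IsManifold (𝓡 n) 1 M := IsManifold.of_le (n := ∞) (by simp)
  rw [← mfderiv_eq_fderiv]
  exact mfderiv_comp_apply q hh.mdifferentiableAt
    ((mdifferentiable_chart p).mdifferentiableAt hq) v

lemma mvfderiv_eq_fderiv_inChart (hf : IsSmoothImmersion (n := n) f) {p q : M}
    (hq : q ∈ (chartAt (EuclideanSpace ℝ (Fin n)) p).source) (v : TangentSpace (𝓡 n) q) :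
    mvfderiv (𝓡 n) f q v =
      fderiv ℝ (inChart f p) (chartAt (EuclideanSpace ℝ (Fin n)) p q) (coordVector p q v) := by
  have hy := (chartAt (EuclideanSpace ℝ (Fin n)) p).map_source hq
  rw [← mvfderiv_comp_chart hq ((contDiffAt_inChart hf p hy).differentiableAt (by simp))]
  have he : f =ᶠ[𝓝 q] inChart f p ∘ chartAt (EuclideanSpace ℝ (Fin n)) p := by
    filter_upwards [(chartAt (EuclideanSpace ℝ (Fin n)) p).open_source.mem_nhds hq] with z hz
    simp [inChart, (chartAt (EuclideanSpace ℝ (Fin n)) p).left_inv hz]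
  exact congrArg (fun L : EuclideanSpace ℝ (Fin n) →L[ℝ] EuclideanSpace ℝ (Fin m) => L v)
    he.mfderiv_eq

lemma isInducedNear_inChart (hf : IsSmoothImmersion (n := n) f) (p : M) :
    IsInducedNear (inChart f p)
      (coordMetric (inducedMetric f) (chartAt (EuclideanSpace ℝ (Fin n)) p))
      (chartAt (EuclideanSpace ℝ (Fin n)) p p) := by
  have : IsManifold (𝓡 n) 1 M := IsManifold.of_le (n := ∞) (by simp)
  have hnhds : ∀ᶠ y in 𝓝 (chartAt (EuclideanSpace ℝ (Fin n)) p p),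
      y ∈ (chartAt (EuclideanSpace ℝ (Fin n)) p).target :=
    (chartAt (EuclideanSpace ℝ (Fin n)) p).open_target.mem_nhds (mem_chart_target _ p)
  refine ⟨?_, ?_, ?_⟩
  · filter_upwards [hnhds] with y hy using contDiffAt_inChart hf p hy
  · filter_upwards [hnhds] with y hy v w hvw
    rw [fderiv_inChart hf p hy, fderiv_inChart hf p hy] at hvw
    exact (mdifferentiable_chart p).symm.mfderiv_injective hy (hf.2 _ hvw)
  · filter_upwards [hnhds] with y hy
    ext i j
    simp only [coordMetric, inducedMetric, Matrix.of_apply, vectorPartial, fderiv_inChart hf p hy]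

lemma differentiableAt_fderiv_inChart (hf : IsSmoothImmersion (n := n) f) (p : M) :
    DifferentiableAt ℝ (fderiv ℝ (inChart f p)) (chartAt (EuclideanSpace ℝ (Fin n)) p p) :=
  ((isInducedNear_inChart hf p).contDiffAt.fderiv_right (m := ∞) le_rfl).differentiableAt (by simp)

lemma normalForm_symm (hf : IsSmoothImmersion (n := n) f) (p : M)
    (v w : EuclideanSpace ℝ (Fin n)) : normalForm f p v w = normalForm f p w v := by
  unfold normalForm
  congr 1
  refine (isInducedNear_inChart hf p).contDiffAt.isSymmSndFDerivAt ?_ _ _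
  simpa using WithTop.coe_le_coe.2 (OrderTop.le_top (2 : ℕ∞))

lemma normalForm_single (hf : IsSmoothImmersion (n := n) f) (p : M) (i j : Fin n) :
    normalForm f p (EuclideanSpace.single i 1) (EuclideanSpace.single j 1) =
      normalHessian (inChart f p)
        (coordMetric (inducedMetric f) (chartAt (EuclideanSpace ℝ (Fin n)) p))
        (chartAt (EuclideanSpace ℝ (Fin n)) p p) i j := by
  rw [(isInducedNear_inChart hf p).normalHessian_eq_starProjection, normalForm]
  congr 1
  unfold vectorPartial
  rw [fderiv_clm_apply (differentiableAt_fderiv_inChart hf p) (differentiableAt_const _)]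
  simp

lemma differentiableAt_coordVector_comp_symm {p : M} {Y : ∀ q : M, TangentSpace (𝓡 n) q}
    (hY : ContMDiffAt (𝓡 n) (𝓡 n).tangent ∞
      (fun q => (⟨q, Y q⟩ : TangentBundle (𝓡 n) M)) p) :
    DifferentiableAt ℝ
      (fun y => coordVector p _ (Y ((chartAt (EuclideanSpace ℝ (Fin n)) p).symm y)))
      (chartAt (EuclideanSpace ℝ (Fin n)) p p) := by
  have : IsManifold (𝓡 n) 1 M := IsManifold.of_le (n := ∞) (by simp)
  have h1 : MDifferentiableAt (𝓡 n) (𝓡 n) (fun q => coordVector p q (Y q)) p := by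
    have h2 := ((Bundle.contMDiffAt_section p).1 hY).mdifferentiableAt (by simp)
    refine h2.congr_of_eventuallyEq ?_
    filter_upwards [(chartAt (EuclideanSpace ℝ (Fin n)) p).open_source.mem_nhds
      (mem_chart_source _ p)] with q hq
    -- The trivialization at `p` is the derivative of the chart at `p`.
    have h3 := TangentBundle.continuousLinearMapAt_trivializationAt (I := 𝓡 n) hq
    have h4 := congrArg (fun L => L (Y q)) h3
    rw [Bundle.Trivialization.continuousLinearMapAt_apply,
      Bundle.Trivialization.linearMapAt_apply, if_pos (by simpa using hq)] at h4
    exact h4.symm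
  rw [← mdifferentiableAt_iff_differentiableAt]
  refine MDifferentiableAt.comp (I' := 𝓡 n) (g := fun q => coordVector p q (Y q)) _ ?_
    ((mdifferentiable_chart p).mdifferentiableAt_symm (mem_chart_target _ p))
  rwa [(chartAt (EuclideanSpace ℝ (Fin n)) p).left_inv (mem_chart_source _ p)]

/-- In coordinates the second fundamental form is the normal part of the Hessian: the derivative of
the coefficients of the second vector field contributes a tangential term only. -/
lemma secondFundamentalForm_eq (hf : IsSmoothImmersion (n := n) f) {p : M}
    (X : ∀ q : M, TangentSpace (𝓡 n) q) {Y : ∀ q : M, TangentSpace (𝓡 n) q}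
    (hY : ContMDiffAt (𝓡 n) (𝓡 n).tangent ∞
      (fun q => (⟨q, Y q⟩ : TangentBundle (𝓡 n) M)) p) :
    secondFundamentalForm f X Y p =
      -normalForm f p (coordVector p p (X p)) (coordVector p p (Y p)) := by
  have : IsManifold (𝓡 n) 1 M := IsManifold.of_le (n := ∞) (by simp)
  set φ := chartAt (EuclideanSpace ℝ (Fin n)) p with hφ
  have hp : p ∈ φ.source := mem_chart_source _ p
  set u : EuclideanSpace ℝ (Fin n) → EuclideanSpace ℝ (Fin n) :=
    fun y => coordVector p _ (Y (φ.symm y)) with hu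
  have hud : DifferentiableAt ℝ u (φ p) := differentiableAt_coordVector_comp_symm hY
  have hFd := differentiableAt_fderiv_inChart hf p
  have he : (fun q => mvfderiv (𝓡 n) f q (Y q)) =ᶠ[𝓝 p]
      (fun y => fderiv ℝ (inChart f p) y (u y)) ∘ φ := by
    filter_upwards [φ.open_source.mem_nhds hp] with q hq
    simp only [Function.comp_apply, hu]
    rw [mvfderiv_eq_fderiv_inChart hf hq, φ.left_inv hq]
  have hder : mvfderiv (𝓡 n) (fun q => mvfderiv (𝓡 n) f q (Y q)) p (X p) =
      fderiv ℝ (inChart f p) (φ p) (fderiv ℝ u (φ p) (coordVector p p (X p))) +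
        fderiv ℝ (fderiv ℝ (inChart f p)) (φ p) (coordVector p p (X p))
          (coordVector p p (Y p)) := by
    have h1 : mvfderiv (𝓡 n) (fun q => mvfderiv (𝓡 n) f q (Y q)) p (X p) =
        mvfderiv (𝓡 n) ((fun y => fderiv ℝ (inChart f p) y (u y)) ∘ φ) p (X p) :=
      congrArg (fun L : EuclideanSpace ℝ (Fin n) →L[ℝ] EuclideanSpace ℝ (Fin m) => L (X p))
        he.mfderiv_eq
    rw [h1, mvfderiv_comp_chart hp (hFd.clm_apply hud), fderiv_clm_apply hFd hud]
    simp only [add_apply, ContinuousLinearMap.comp_apply, ContinuousLinearMap.flip_apply, hu]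
    rw [φ.left_inv hp]
  have hrange : (mvfderiv (𝓡 n) f p).range = (fderiv ℝ (inChart f p) (φ p)).range := by
    ext z
    constructor
    · rintro ⟨v, rfl⟩
      exact ⟨coordVector p p v, (mvfderiv_eq_fderiv_inChart hf hp v).symm⟩
    · rintro ⟨w, rfl⟩
      obtain ⟨v, hv⟩ := (mdifferentiable_chart (I := 𝓡 n) p).mfderiv_surjective hp w
      refine ⟨v, ?_⟩
      have := mvfderiv_eq_fderiv_inChart hf hp v
      exact this.trans (congrArg _ hv)
  unfold secondFundamentalForm normalProj normalForm
  rw [hder, neg_inj]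
  -- The derivative of the coefficients of `Y` lies in the tangent space and is projected away.
  simp only [hrange, map_add]
  rw [Submodule.starProjection_orthogonal_apply_eq_zero, zero_add]
  exact ⟨_, rfl⟩

/-- The Gauss equation in coordinates, with the normal parts of both Hessians. -/
lemma curvatureLower_coordMetric (hf : IsSmoothImmersion (n := n) f) (p : M) (a b c d : Fin n) :
    curvatureLower (coordMetric (inducedMetric f) (chartAt (EuclideanSpace ℝ (Fin n)) p)) a b c d
        (chartAt (EuclideanSpace ℝ (Fin n)) p p) =
      inner ℝ (normalForm f p (EuclideanSpace.single a 1) (EuclideanSpace.single c 1))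
          (normalForm f p (EuclideanSpace.single b 1) (EuclideanSpace.single d 1)) -
        inner ℝ (normalForm f p (EuclideanSpace.single a 1) (EuclideanSpace.single d 1))
          (normalForm f p (EuclideanSpace.single b 1) (EuclideanSpace.single c 1)) := by
  have h := isInducedNear_inChart hf p
  have hproj : ∀ a b c d, inner ℝ
      (normalHessian (inChart f p)
        (coordMetric (inducedMetric f) (chartAt (EuclideanSpace ℝ (Fin n)) p))
        (chartAt (EuclideanSpace ℝ (Fin n)) p p) b d)
      (vectorPartial a (vectorPartial c (inChart f p)) (chartAt (EuclideanSpace ℝ (Fin n)) p p)) =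
      inner ℝ (normalForm f p (EuclideanSpace.single b 1) (EuclideanSpace.single d 1))
        (normalForm f p (EuclideanSpace.single a 1) (EuclideanSpace.single c 1)) := by
    intro a b c d
    rw [normalForm_single hf, normalForm_single hf, h.normalHessian_eq_starProjection,
      h.normalHessian_eq_starProjection, ← Submodule.inner_starProjection_left_eq_right,
      Submodule.starProjection_eq_self_iff.2 (Submodule.starProjection_apply_mem _ _)]

  rw [h.curvatureLower_eq, hproj, hproj, real_inner_comm]

/-- The Gauss equation. -/
lemma riemann_inducedMetric (hf : IsSmoothImmersion (n := n) f) (p : M)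
    (v w y z : TangentSpace (𝓡 n) p) :
    riemann (inducedMetric f) p v w y z =
      inner ℝ (normalForm f p (coordVector p p v) (coordVector p p y))
          (normalForm f p (coordVector p p w) (coordVector p p z)) -
        inner ℝ (normalForm f p (coordVector p p v) (coordVector p p z))
          (normalForm f p (coordVector p p w) (coordVector p p y)) := by
  have h1 := sum_coord_mul_inner (normalFormₗ f p) (coordVector p p v) (coordVector p p w)
    (coordVector p p y) (coordVector p p z)
  have h2 := sum_coord_mul_inner (normalFormₗ f p) (coordVector p p v) (coordVector p p w)
    (coordVector p p z) (coordVector p p y)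
  have hR : riemann (inducedMetric f) p v w y z = ∑ a, ∑ b, ∑ c, ∑ d,
      coordVector p p v a * coordVector p p w b * coordVector p p y c * coordVector p p z d *
        curvatureLower (coordMetric (inducedMetric f) (chartAt (EuclideanSpace ℝ (Fin n)) p)) a b c d
          (chartAt (EuclideanSpace ℝ (Fin n)) p p) := rfl
  simp only [normalFormₗ_apply] at h1 h2
  rw [hR, ← h1, ← h2]
  simp only [curvatureLower_coordMetric hf, mul_sub, Finset.sum_sub_distrib]
  refine congrArg₂ _ rfl (Finset.sum_congr rfl fun a _ => Finset.sum_congr rfl fun b _ => ?_)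
  rw [Finset.sum_comm]
  exact Finset.sum_congr rfl fun d _ => Finset.sum_congr rfl fun c _ => by ring

end Immersion

end Submfd

end

theorem mainTheorem6 {n m : ℕ} {M : Type*} [TopologicalSpace M]
    [ChartedSpace (EuclideanSpace ℝ (Fin n)) M] [IsManifold (𝓡 n) ∞ M]
    (f : M → EuclideanSpace ℝ (Fin m)) (hf : Submfd.IsSmoothImmersion (n := n) f)
    (k : ℕ) (hk : 1 ≤ k) (hkn : k ≤ n / 2)
    (p : M) (e : Fin n → ∀ q : M, TangentSpace (𝓡 n) q)
    (he : Submfd.IsOrthonormalFrameAt (Submfd.inducedMetric f) e p) (i j : Fin n) :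
    Submfd.einsteinTensor (Submfd.inducedMetric f) k e p i j =
      (((2 * k).factorial : ℝ) / 2) * Submfd.newtonTensorEven f k e p i j := by
  open Submfd in
  have hA : ∀ a b, secondFundamentalForm f (e a) (e b) p =
      -normalForm f p (coordVector p p (e a p)) (coordVector p p (e b p)) :=
    fun a b => secondFundamentalForm_eq hf (e a) (he.smooth b)
  set N : Fin n → Fin n → EuclideanSpace ℝ (Fin m) := fun a b =>
    normalForm f p (coordVector p p (e a p)) (coordVector p p (e b p)) with hN
  have hsymm : ∀ a b, N a b = N b a := fun a b => normalForm_symm hf p _ _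
  -- For fixed lower indices, the upper indices of each curvature factor are antisymmetrized.
  have hsum : ∀ J : Fin (2 * k) → Fin n,
      ∑ I : Fin (2 * k) → Fin n, kronecker (Fin.cons i I : Fin (2 * k + 1) → Fin n) (Fin.cons j J) *
        ∏ s : Fin k, riemann (inducedMetric f) p (e (J (evenPos s)) p) (e (J (oddPos s)) p)
          (e (I (evenPos s)) p) (e (I (oddPos s)) p) =
      2 ^ k * ∑ I : Fin (2 * k) → Fin n,
        kronecker (Fin.cons i I : Fin (2 * k + 1) → Fin n) (Fin.cons j J) *
        ∏ s : Fin k, inner ℝ (secondFundamentalForm f (e (I (evenPos s))) (e (J (evenPos s))) p)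
          (secondFundamentalForm f (e (I (oddPos s))) (e (J (oddPos s))) p) := by
    intro J
    have h := sum_mul_prod_sub_swap
      (fun I => kronecker (Fin.cons i I : Fin (2 * k + 1) → Fin n) (Fin.cons j J))
      (fun I s => kronecker_cons_comp_swap i j I J (evenPos_ne_oddPos s s))
      (fun s a b => inner ℝ (N (J (evenPos s)) a) (N (J (oddPos s)) b))
    simp only [riemann_inducedMetric hf, hA, inner_neg_neg]
    refine h.trans ?_
    refine congrArg _ (Finset.sum_congr rfl fun I _ => congrArg _
      (Finset.prod_congr rfl fun s _ => ?_))
    rw [hsymm (J (evenPos s)), hsymm (J (oddPos s))]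
  unfold einsteinTensor newtonTensorEven
  rw [Finset.sum_comm, Finset.sum_congr rfl fun J _ => hsum J, ← Finset.mul_sum, Finset.sum_comm]
  field_simp
  ring
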